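/- Let $n\ge 3$, let $\emptyset\neq\Omega\subset\mathbb{R}^n$ be a bounded open set with smooth boundary which is mean-convex, i.e. the Euclidean mean curvature of $\partial\Omega$ with respect to the normal pointing out of $\Omega$ is positive everywhere (round balls have positive mean curvature). Let $M=\mathbb{R}^n\setminus\Omega$, let $u>0$ be a smooth function on $M$ (up to the boundary), and let $g=u^{4/(n-2)}\delta_{ij}$. Suppose that 1. $(M,g)$ is asymptotically flat: there are a compact set $K\subset M$ and a diffeomorphism from $M\setminus K$ onto $\{y\in\mathbb{R}^n:|y|>1\}$ such that in this chart $$g_{ij}=\delta_{ij}+O(|y|^{-p}),\quad g_{ij,k}=O(|y|^{-p-1}),\quad g_{ij,kl}=O(|y|^{-p-2}),\quad R_g=O(|y|^{-q})$$ for some $p>(n-2)/2$ and some $q>n$, where $R_g$ is the scalar curvature of $g$; 2. $R_g\ge 0$ on $M$; 3. the boundary $\partial M=\partial\Omega$ is a minimal hypersurface of $(M,g)$, i.e. its mean curvature with respect to $g$ vanishes identically; 4. $u(x)\to 1$ as $|x|\to\infty$. Then $u\ge 1$ on all of $M$. -/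

import Mathlib

open Filter Topology Asymptotics
open scoped ContDiff

noncomputable section

/-- Euclidean `n`-space. -/
abbrev Euc (n : ℕ) : Type := EuclideanSpace ℝ (Fin n)

namespace ConfFlat

/-- The partial derivative `∂ᵢ f` at `x`, for a function `f` on the region `S` (at boundary points
of `S` this is the derivative from within `S`). -/
def pderiv {n : ℕ} (S : Set (Euc n)) (f : Euc n → ℝ) (i : Fin n) (x : Euc n) : ℝ :=
  fderivWithin ℝ f S x (EuclideanSpace.single i 1)

/-! A Riemannian metric on a region `S` of `ℝⁿ` is given by its components `g x i j = gᵢⱼ(x)` in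
the standard coordinates; `(g x)⁻¹ i j = gⁱʲ(x)`. -/

/-- Christoffel symbols of the Levi-Civita connection of `g`:
`Γᵏᵢⱼ = ½ gᵏˡ (∂ᵢ gⱼₗ + ∂ⱼ gᵢₗ - ∂ₗ gᵢⱼ)`. -/
def christoffel {n : ℕ} (S : Set (Euc n)) (g : Euc n → Matrix (Fin n) (Fin n) ℝ)
    (k i j : Fin n) (x : Euc n) : ℝ :=
  (1 / 2 : ℝ) * ∑ l, (g x)⁻¹ k l *
    (pderiv S (fun y => g y j l) i x + pderiv S (fun y => g y i l) j x
      - pderiv S (fun y => g y i j) l x)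

/-- Ricci curvature:
`Rᵢⱼ = ∂ₖ Γᵏᵢⱼ - ∂ⱼ Γᵏᵢₖ + Γᵏₖₗ Γˡᵢⱼ - Γᵏⱼₗ Γˡᵢₖ`. -/
def ricci {n : ℕ} (S : Set (Euc n)) (g : Euc n → Matrix (Fin n) (Fin n) ℝ)
    (i j : Fin n) (x : Euc n) : ℝ :=
  (∑ k, (pderiv S (christoffel S g k i j) k x - pderiv S (christoffel S g k i k) j x))
    + ∑ k, ∑ l, (christoffel S g k k l x * christoffel S g l i j x
        - christoffel S g k j l x * christoffel S g l i k x)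

/-- Scalar curvature `R = gⁱʲ Rᵢⱼ`. -/
def scalarCurvature {n : ℕ} (S : Set (Euc n)) (g : Euc n → Matrix (Fin n) (Fin n) ℝ)
    (x : Euc n) : ℝ :=
  ∑ i, ∑ j, (g x)⁻¹ i j * ricci S g i j x

/-- The Euclidean metric `δᵢⱼ`. -/
def euclideanMetric (n : ℕ) : Euc n → Matrix (Fin n) (Fin n) ℝ := fun _ => 1

/-- The conformally flat metric `u^{4/(n-2)} δᵢⱼ`. -/
def conformalMetric {n : ℕ} (u : Euc n → ℝ) : Euc n → Matrix (Fin n) (Fin n) ℝ :=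
  fun x => (u x ^ (4 / ((n : ℝ) - 2))) • (1 : Matrix (Fin n) (Fin n) ℝ)

/-- `ρ` is a smooth local defining function of the open set `Ω` at the boundary point `p`: near `p`
the set `Ω` is `{ρ < 0}`, and `dρ ≠ 0`. -/
def IsLocalDefiningFunction {n : ℕ} (Ω : Set (Euc n)) (p : Euc n) (ρ : Euc n → ℝ) : Prop :=
  ∃ U : Set (Euc n), IsOpen U ∧ p ∈ U ∧ ContDiffOn ℝ ∞ ρ U ∧
    (∀ x ∈ U, fderiv ℝ ρ x ≠ 0) ∧ ∀ x ∈ U, (x ∈ Ω ↔ ρ x < 0)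

/-- The boundary of the open set `Ω` is smooth: it is a smooth hypersurface with `Ω` locally on
exactly one side of it. -/
def HasSmoothBoundary {n : ℕ} (Ω : Set (Euc n)) : Prop :=
  ∀ p ∈ frontier Ω, ∃ ρ : Euc n → ℝ, IsLocalDefiningFunction Ω p ρ

/-- `|dρ|_g`, where `|dρ|_g² = gⁱʲ ∂ᵢρ ∂ⱼρ`. -/
def gradNorm {n : ℕ} (g : Euc n → Matrix (Fin n) (Fin n) ℝ) (ρ : Euc n → ℝ) (x : Euc n) : ℝ :=
  Real.sqrt (∑ i, ∑ j, (g x)⁻¹ i j * pderiv Set.univ ρ i x * pderiv Set.univ ρ j x)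

/-- The `g`-unit normal `νⁱ = gⁱʲ ∂ⱼρ / |dρ|_g` of the level set of `ρ` through `x`, pointing
towards increasing `ρ`. -/
def unitNormal {n : ℕ} (g : Euc n → Matrix (Fin n) (Fin n) ℝ) (ρ : Euc n → ℝ)
    (i : Fin n) (x : Euc n) : ℝ :=
  (∑ j, (g x)⁻¹ i j * pderiv Set.univ ρ j x) / gradNorm g ρ x

/-- The Hessian of `ρ` for the Levi-Civita connection of `g`: `∂ᵢ∂ⱼρ - Γᵏᵢⱼ ∂ₖρ`. -/
def hessian {n : ℕ} (S : Set (Euc n)) (g : Euc n → Matrix (Fin n) (Fin n) ℝ) (ρ : Euc n → ℝ)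
    (i j : Fin n) (x : Euc n) : ℝ :=
  pderiv Set.univ (pderiv Set.univ ρ j) i x
    - ∑ k, christoffel S g k i j x * pderiv Set.univ ρ k x

/-- The mean curvature at `x`, with respect to `g`, of the level set of `ρ` through `x`, with unit
normal `ν` pointing towards increasing `ρ`. The second fundamental form
`(X, Y) ↦ g(∇_X ν, Y)` on tangent vectors of the level set is the restriction of
`Hess_g ρ / |dρ|_g`; the mean curvature is its trace, taken with the inverse `gⁱʲ - νⁱ νʲ` of the
induced metric. (The unit sphere `{|x|² - 1 = 0}` in Euclidean space has mean curvature `n - 1`.) -/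
def meanCurvature {n : ℕ} (S : Set (Euc n)) (g : Euc n → Matrix (Fin n) (Fin n) ℝ)
    (ρ : Euc n → ℝ) (x : Euc n) : ℝ :=
  ∑ i, ∑ j, ((g x)⁻¹ i j - unitNormal g ρ i x * unitNormal g ρ j x)
    * (hessian S g ρ i j x / gradNorm g ρ x)

/-- `Ω` is mean-convex: the Euclidean mean curvature of its boundary, with respect to the normal
pointing out of `Ω`, is positive everywhere. The value of the mean curvature does not depend on the
local defining function. -/
def IsMeanConvex {n : ℕ} (Ω : Set (Euc n)) : Prop :=
  ∀ p ∈ frontier Ω, ∀ ρ : Euc n → ℝ, IsLocalDefiningFunction Ω p ρ →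
    0 < meanCurvature Ωᶜ (euclideanMetric n) ρ p

/-- The boundary of `M = ℝⁿ \ Ω` is a minimal hypersurface of `(M, g)`: its mean curvature with
respect to `g` vanishes identically. -/
def HasMinimalBoundary {n : ℕ} (Ω : Set (Euc n)) (g : Euc n → Matrix (Fin n) (Fin n) ℝ) : Prop :=
  ∀ p ∈ frontier Ω, ∀ ρ : Euc n → ℝ, IsLocalDefiningFunction Ω p ρ →
    meanCurvature Ωᶜ g ρ p = 0

/-- The exterior `ℝⁿ \ B₁(0)` of the closed unit ball. -/
def exteriorRegion (n : ℕ) : Set (Euc n) := {y | 1 < ‖y‖}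

/-- The components `(Ψ^* g)ᵢⱼ = (g_ab ∘ Ψ) ∂ᵢΨᵃ ∂ⱼΨᵇ` of `g` in the coordinates `y` given by the
parametrization `x = Ψ(y)`, for `y` in the exterior region. -/
def pullbackMetric {n : ℕ} (Ψ : Euc n → Euc n) (g : Euc n → Matrix (Fin n) (Fin n) ℝ) :
    Euc n → Matrix (Fin n) (Fin n) ℝ :=
  fun y i j => ∑ a, ∑ b, g (Ψ y) a b
    * pderiv (exteriorRegion n) (fun z => Ψ z a) i y
    * pderiv (exteriorRegion n) (fun z => Ψ z b) j y

/-- The Riemannian manifold `(S, g)`, `S` a region of `ℝⁿ`, is asymptotically flat: off a compact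
set `K` it is diffeomorphic (`Φ`, with inverse `Ψ`) to the exterior of the unit ball, and in this
chart the metric and the scalar curvature have the usual decay, with rates `p > (n - 2) / 2` and
`q > n`. -/
def IsAsymptoticallyFlat {n : ℕ} (S : Set (Euc n)) (g : Euc n → Matrix (Fin n) (Fin n) ℝ) : Prop :=
  ∃ K : Set (Euc n), K ⊆ S ∧ IsCompact K ∧
  ∃ Φ Ψ : Euc n → Euc n,
    ContDiffOn ℝ ∞ Φ (S \ K) ∧ ContDiffOn ℝ ∞ Ψ (exteriorRegion n) ∧
    Set.MapsTo Φ (S \ K) (exteriorRegion n) ∧ Set.MapsTo Ψ (exteriorRegion n) (S \ K) ∧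
    Set.InvOn Ψ Φ (S \ K) (exteriorRegion n) ∧
  ∃ p q : ℝ, ((n : ℝ) - 2) / 2 < p ∧ (n : ℝ) < q ∧
    (∀ i j, (fun y => pullbackMetric Ψ g y i j - (1 : Matrix (Fin n) (Fin n) ℝ) i j)
      =O[Bornology.cobounded (Euc n)] fun y => ‖y‖ ^ (-p)) ∧
    (∀ i j k, (pderiv (exteriorRegion n) (fun y => pullbackMetric Ψ g y i j) k)
      =O[Bornology.cobounded (Euc n)] fun y => ‖y‖ ^ (-p - 1)) ∧
    (∀ i j k l, (pderiv (exteriorRegion n)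
        (pderiv (exteriorRegion n) (fun y => pullbackMetric Ψ g y i j) k) l)
      =O[Bornology.cobounded (Euc n)] fun y => ‖y‖ ^ (-p - 2)) ∧
    (fun y => scalarCurvature S g (Ψ y))
      =O[Bornology.cobounded (Euc n)] fun y => ‖y‖ ^ (-q)

end ConfFlat

end

/-! The scalar curvature of `u^{4/(n-2)} δ` is a negative multiple of `Δu`, so `R_g ≥ 0` makes `u`
superharmonic in the interior of `M` (`sum_pderiv_pderiv_nonpos`). By the weak minimum principle
(`exists_isMinOn_diff_interior`), a value of `u` below `1 = u(∞)` forces a minimum of `u` on `∂Ω`.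

There the conformal change of mean curvature (`meanCurvature_smul_one`) decides: `0 = H_g` is a
positive multiple of `H + c ∂_ν f`, where `f = u^{4/(n-2)}`, `c > 0` and `ν` points into `M`. Since
`H > 0`, `f` strictly decreases into `M`, which is impossible at a minimum
(`not_isLocalMinOn_of_minimal`). Strict mean-convexity thus takes the place of the Hopf lemma. -/

namespace ConfFlat

variable {n : ℕ} {S : Set (Euc n)} {f : Euc n → ℝ} {x : Euc n}

/-! ### Scalar curvature of a metric `f δ` -/

theorem inv_smul_one_apply {c : ℝ} (hc : c ≠ 0) (i j : Fin n) :
    (c • (1 : Matrix (Fin n) (Fin n) ℝ))⁻¹ i j = if i = j then c⁻¹ else 0 := by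
  have h : (c • (1 : Matrix (Fin n) (Fin n) ℝ))⁻¹ = c⁻¹ • 1 :=
    Matrix.inv_eq_right_inv (by simp [smul_smul, hc])
  simp [h, Matrix.one_apply]

theorem pderiv_smul_one (i j k : Fin n) :
    pderiv S (fun y => (f y • (1 : Matrix (Fin n) (Fin n) ℝ)) i j) k x
      = if i = j then pderiv S f k x else 0 := by
  by_cases h : i = j <;> simp [pderiv, h]

theorem christoffel_smul_one (hf : f x ≠ 0) (k i j : Fin n) :
    christoffel S (fun y => f y • 1) k i j x
      = (if k = j then pderiv S f i x / (2 * f x) else 0)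
        + (if k = i then pderiv S f j x / (2 * f x) else 0)
        - (if i = j then pderiv S f k x / (2 * f x) else 0) := by
  simp only [christoffel, inv_smul_one_apply hf, pderiv_smul_one, ite_mul, zero_mul,
    Finset.sum_ite_eq, Finset.mem_univ, if_true]
  simp only [eq_comm (a := k)]
  split_ifs <;> field_simp <;> ring

/-- With `f = e^{2φ}`, the quotients `∂ᵢf / (2f)` are `∂ᵢφ`, and this is the classical `R = -e^{-2φ}
(n-1) (2Δφ + (n-2)|∇φ|²)`. Tracing leaves only the divergence of `∂φ`, so symmetry of second
derivatives plays no role. -/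
theorem scalarCurvature_smul_one (hf : ∀ y ∈ S, f y ≠ 0) (hx : S ∈ 𝓝 x)
    (hP : ∀ i, DifferentiableAt ℝ (fun y => pderiv S f i y / (2 * f y)) x) :
    scalarCurvature S (fun y => f y • 1) x
      = -((f x)⁻¹ * ((n - 1) * (2 * ∑ i, pderiv S (fun y => pderiv S f i y / (2 * f y)) i x
          + (n - 2) * ∑ i, (pderiv S f i x / (2 * f x)) ^ 2))) := by
  have hxS : x ∈ S := mem_of_mem_nhds hx
  set P : Fin n → Euc n → ℝ := fun i y => pderiv S f i y / (2 * f y) with hPdef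
  have hu : UniqueDiffWithinAt ℝ S x := uniqueDiffWithinAt_of_mem_nhds hx
  have hΓ : ∀ k i j, ∀ y ∈ S, christoffel S (fun y => f y • 1) k i j y
      = (if k = j then P i y else 0) + (if k = i then P j y else 0)
        - (if i = j then P k y else 0) := fun k i j y hy => christoffel_smul_one (hf y hy) k i j
  have hdite : ∀ (c : Prop) [Decidable c] (i : Fin n),
      DifferentiableWithinAt ℝ (fun y => if c then P i y else 0) S x := by
    intro c _ i
    by_cases h : c
    · simpa [h] using (hP i).differentiableWithinAt
    · simpa [h] using differentiableWithinAt_const (0 : ℝ)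
  have hpite : ∀ (c : Prop) [Decidable c] (i l : Fin n),
      fderivWithin ℝ (fun y => if c then P i y else 0) S x (EuclideanSpace.single l 1)
        = if c then pderiv S (P i) l x else 0 := by
    intro c _ i l
    by_cases h : c <;> simp [h, pderiv]
  have hdΓ : ∀ k i j l, pderiv S (christoffel S (fun y => f y • 1) k i j) l x
      = (if k = j then pderiv S (P i) l x else 0) + (if k = i then pderiv S (P j) l x else 0)
        - (if i = j then pderiv S (P k) l x else 0) := by
    intro k i j l
    rw [pderiv, fderivWithin_congr (hΓ k i j) (hΓ k i j x hxS),
      fderivWithin_fun_sub hu ((hdite (k = j) i).fun_add (hdite (k = i) j)) (hdite (i = j) k),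
      fderivWithin_fun_add hu (hdite (k = j) i) (hdite (k = i) j)]
    simp only [sub_apply, add_apply, hpite]
  simp only [scalarCurvature, inv_smul_one_apply (hf x hxS), ite_mul, zero_mul,
    Finset.sum_ite_eq, Finset.mem_univ, if_true, ricci, hdΓ, hΓ _ _ _ x hxS]
  change _ = -((f x)⁻¹ * ((n - 1) * (2 * ∑ i, pderiv S (P i) i x
          + (n - 2) * ∑ i, P i x ^ 2)))
  rw [← Finset.mul_sum, ← mul_neg, Finset.sum_add_distrib]
  congr 1
  have h1 : ∑ i, ∑ k, (((if k = i then pderiv S (P i) k x else 0)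
        + (if k = i then pderiv S (P i) k x else 0)
        - pderiv S (P k) k x)
      - (pderiv S (P i) i x + (if k = i then pderiv S (P k) i x else 0)
        - (if i = k then pderiv S (P k) i x else 0)))
      = (2 - 2 * n) * ∑ i, pderiv S (P i) i x := by
    simp only [Finset.sum_sub_distrib, Finset.sum_add_distrib, Finset.sum_ite_eq,
      Finset.sum_ite_eq', Finset.mem_univ, if_true, Finset.sum_const, Finset.card_univ,
      Fintype.card_fin, nsmul_eq_mul, ← Finset.mul_sum]
    ring
  have h2 : ∑ i, ∑ k, ∑ l, (((if k = l then P k x else 0) + P l x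
        - (if k = l then P k x else 0)) * ((if l = i then P i x else 0)
          + (if l = i then P i x else 0) - P l x)
      - ((if k = l then P i x else 0) + (if k = i then P l x else 0)
        - (if i = l then P k x else 0)) * ((if l = k then P i x else 0)
          + (if l = i then P k x else 0) - (if i = k then P l x else 0)))
      = (n - 1) * (2 - n) * ∑ i, P i x ^ 2 := by
    -- Products of Kronecker deltas are first rewritten termwise so that each sum over `i`, `k`, `l`
    -- collapses.
    have h3 : ∀ i k l : Fin n, (((if k = l then P k x else 0) + P l x
        - (if k = l then P k x else 0)) * ((if l = i then P i x else 0)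
          + (if l = i then P i x else 0) - P l x)
      - ((if k = l then P i x else 0) + (if k = i then P l x else 0)
        - (if i = l then P k x else 0)) * ((if l = k then P i x else 0)
          + (if l = i then P k x else 0) - (if i = k then P l x else 0)))
        = (if i = l then 2 * P i x ^ 2 else 0) - P l x ^ 2 - (if k = l then P i x ^ 2 else 0)
          + (if i = k then P l x ^ 2 else 0) + (if i = l then P k x ^ 2 else 0)
          - (if i = k then (if i = l then 2 * P i x ^ 2 else 0) else 0) := by
      intro i k l
      by_cases a : k = l <;> by_cases b : k = i <;> by_cases c : i = l <;> grind
    have h4 : ∀ i k, ∑ l, (if i = k then (if i = l then 2 * P i x ^ 2 else 0) else 0)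
        = if i = k then 2 * P i x ^ 2 else 0 := by
      intro i k
      by_cases h : i = k <;> simp [h]
    have h5 : ∀ i k : Fin n, ∑ l, (if i = k then P l x ^ 2 else 0)
        = if i = k then ∑ l, P l x ^ 2 else 0 := by
      intro i k
      by_cases h : i = k <;> simp [h]
    simp only [h3, Finset.sum_sub_distrib, Finset.sum_add_distrib, h4, h5, Finset.sum_ite_eq,
      Finset.mem_univ, if_true, Finset.sum_const, Finset.card_univ,
      Fintype.card_fin, nsmul_eq_mul, ← Finset.mul_sum]
    ring
  rw [h1, h2]
  ring

/-! ### Mean curvature under conformal change -/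

theorem hessian_euclideanMetric (ρ : Euc n → ℝ) (i j : Fin n) :
    hessian S (euclideanMetric n) ρ i j x
      = pderiv Set.univ (pderiv Set.univ ρ j) i x := by
  simp [hessian, christoffel, euclideanMetric, pderiv]

theorem meanCurvature_euclideanMetric (ρ : Euc n → ℝ) :
    meanCurvature S (euclideanMetric n) ρ x
      = (∑ i, ∑ j, ((if i = j then 1 else 0) - pderiv Set.univ ρ i x * pderiv Set.univ ρ j x
          / (∑ k, pderiv Set.univ ρ k x ^ 2)) * pderiv Set.univ (pderiv Set.univ ρ j) i x)
        / √(∑ k, pderiv Set.univ ρ k x ^ 2) := by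
  have h0 : (0 : ℝ) ≤ ∑ k, pderiv Set.univ ρ k x ^ 2 := Finset.sum_nonneg fun _ _ => sq_nonneg _
  simp only [meanCurvature, hessian_euclideanMetric, unitNormal, gradNorm, euclideanMetric,
    inv_one, Matrix.one_apply, ite_mul, one_mul, zero_mul, Finset.sum_ite_eq, Finset.mem_univ,
    if_true, ← pow_two, div_mul_div_comm, Finset.sum_div, mul_div_assoc]
  simp only [Real.sq_sqrt h0]

/-- With `f = e^{2φ}`, the Hessian of `ρ` changes by `-(dφ ⊗ dρ + dρ ⊗ dφ) + ⟨∇φ, ∇ρ⟩ δ`. The first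
two terms vanish on tangent vectors of the level set; the last has trace `(n-1)⟨∇φ, ∇ρ⟩` there. -/
theorem meanCurvature_smul_one (ρ : Euc n → ℝ) (hf : 0 < f x)
    (hρ : 0 < ∑ k, pderiv Set.univ ρ k x ^ 2) :
    meanCurvature S (fun y => f y • 1) ρ x
      = (√(f x))⁻¹ * (meanCurvature S (euclideanMetric n) ρ x
        + (n - 1) / (2 * f x * √(∑ k, pderiv Set.univ ρ k x ^ 2))
          * ∑ k, pderiv Set.univ ρ k x * pderiv S f k x) := by
  rw [meanCurvature_euclideanMetric]
  have hgrad : gradNorm (fun y => f y • 1) ρ x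
      = (√(f x))⁻¹ * √(∑ k, pderiv Set.univ ρ k x ^ 2) := by
    simp only [gradNorm, inv_smul_one_apply hf.ne', ite_mul, zero_mul, Finset.sum_ite_eq,
      Finset.mem_univ, if_true, mul_assoc, ← pow_two, ← Finset.mul_sum]
    rw [Real.sqrt_mul (inv_nonneg.2 hf.le), Real.sqrt_inv]
  have hnorm : ∀ i, unitNormal (fun y => f y • 1) ρ i x
      = (f x)⁻¹ * pderiv Set.univ ρ i x / gradNorm (fun y => f y • 1) ρ x := by
    intro i
    simp only [unitNormal, inv_smul_one_apply hf.ne', ite_mul, zero_mul, Finset.sum_ite_eq,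
      Finset.mem_univ, if_true]
  have hhess : ∀ i j, hessian S (fun y => f y • 1) ρ i j x
      = pderiv Set.univ (pderiv Set.univ ρ j) i x
        - (2 * f x)⁻¹ * (pderiv S f i x * pderiv Set.univ ρ j x
          + pderiv S f j x * pderiv Set.univ ρ i x
          - if i = j then ∑ k, pderiv Set.univ ρ k x * pderiv S f k x else 0) := by
    intro i j
    simp only [hessian, christoffel_smul_one hf.ne', add_mul, sub_mul, ite_mul, zero_mul,
      Finset.sum_sub_distrib, Finset.sum_add_distrib, Finset.sum_ite_eq', Finset.mem_univ, if_true]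
    by_cases h : i = j
    · simp only [h, if_true, mul_sub, Finset.mul_sum]
      congr 1
      congr 1
      · field_simp
      · exact Finset.sum_congr rfl fun _ _ => by field_simp
    · simp only [h, if_false, Finset.sum_const_zero, sub_zero]
      field_simp
  simp only [meanCurvature, hhess, hnorm, hgrad, inv_smul_one_apply hf.ne']
  set a : Fin n → ℝ := fun k => pderiv Set.univ ρ k x with ha
  set b : Fin n → ℝ := fun k => pderiv S f k x with hb
  set N := ∑ k, a k ^ 2 with hN
  set A := ∑ k, a k * b k with hA
  have hs : √N ≠ 0 := (Real.sqrt_pos.2 hρ).ne'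
  have hsf : √(f x) ≠ 0 := (Real.sqrt_pos.2 hf).ne'
  have hs2 : √N ^ 2 = N := Real.sq_sqrt hρ.le
  have hsf2 : √(f x) ^ 2 = f x := Real.sq_sqrt hf.le
  have hterm : ∀ i j, ((if i = j then (f x)⁻¹ else 0)
        - (f x)⁻¹ * a i / ((√(f x))⁻¹ * √N) * ((f x)⁻¹ * a j / ((√(f x))⁻¹ * √N)))
      * ((pderiv Set.univ (pderiv Set.univ ρ j) i x - (2 * f x)⁻¹ * (b i * a j + b j * a i
          - if i = j then A else 0)) / ((√(f x))⁻¹ * √N))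
      = (√(f x))⁻¹ * (((if i = j then 1 else 0) - a i * a j / N)
          * pderiv Set.univ (pderiv Set.univ ρ j) i x / √N
        - (2 * f x * √N)⁻¹ * (((if i = j then 2 * (a i * b i) - A else 0)
          - (a i * b i) * a j ^ 2 / N - a i ^ 2 * (a j * b j) / N
          + (if i = j then a i ^ 2 * A / N else 0)))) := by
    intro i j
    generalize pderiv Set.univ (pderiv Set.univ ρ j) i x = h
    generalize √N = s at *
    rw [← hs2]
    have : f x = √(f x) ^ 2 := hsf2.symm
    rw [this, Real.sqrt_sq (Real.sqrt_nonneg _)]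
    generalize √(f x) = t at *
    by_cases e : i = j
    · subst e
      simp only [if_true]
      field_simp
      ring
    · simp only [e, if_false]
      field_simp
      ring
  simp only [ha, hb] at hterm
  simp only [hterm, ← Finset.mul_sum, Finset.sum_sub_distrib, Finset.sum_add_distrib,
    Finset.sum_ite_eq, Finset.mem_univ, if_true, ← Finset.sum_div, ← Finset.sum_mul,
    Finset.sum_const, Finset.card_univ, Fintype.card_fin, nsmul_eq_mul]
  -- The bracket equals `-(n-1) A`.
  change _ * (_ / √N - _ * (2 * A - n * A - A * N / N - N * A / N + N * A / N)) = _
  congr 1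
  rw [sub_eq_add_neg]
  congr 1
  have hN0 : N ≠ 0 := hρ.ne'
  field_simp
  ring

/-! ### No minimum on a minimal boundary -/

theorem fderiv_apply_eq_sum_pderiv (S : Set (Euc n)) (f : Euc n → ℝ) (x v : Euc n) :
    fderivWithin ℝ f S x v = ∑ i, v i * pderiv S f i x := by
  conv_lhs => rw [← (EuclideanSpace.basisFun (Fin n) ℝ).sum_repr v]
  simp [pderiv]

theorem IsLocalDefiningFunction.eq_zero {Ω : Set (Euc n)} {p : Euc n} {ρ : Euc n → ℝ}
    (hΩ : IsOpen Ω) (hp : p ∈ frontier Ω) (h : IsLocalDefiningFunction Ω p ρ) : ρ p = 0 := by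
  obtain ⟨U, hU, hpU, hρ, -, hΩρ⟩ := h
  have hpΩ : p ∉ Ω := by
    rw [hΩ.frontier_eq] at hp
    exact hp.2
  refine le_antisymm ?_ (not_lt.1 fun hlt => hpΩ ((hΩρ p hpU).2 hlt))
  by_contra! hpos
  have hev : ∀ᶠ y in 𝓝 p, 0 < ρ y :=
    (hρ.continuousOn.continuousAt (hU.mem_nhds hpU)).eventually (lt_mem_nhds hpos)
  obtain ⟨y, ⟨hy, hyU⟩, hyΩ⟩ := mem_closure_iff_nhds.1 (frontier_subset_closure hp) _
    (hev.and (hU.mem_nhds hpU))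
  exact lt_asymm hy ((hΩρ y hyU).1 hyΩ)

/-- As `ρ p = 0`, moving along a direction of increase of `ρ` makes `ρ` positive at once, so the ray
stays outside `Ω` for small times. This makes the one-sided first derivative test available at the
boundary. -/
theorem IsLocalDefiningFunction.gradient_mem_posTangentConeAt {Ω : Set (Euc n)} {p : Euc n}
    {ρ : Euc n → ℝ} (hΩ : IsOpen Ω) (hp : p ∈ frontier Ω) (h : IsLocalDefiningFunction Ω p ρ)
    {v : Euc n} (hv : 0 < fderiv ℝ ρ p v) : v ∈ posTangentConeAt Ωᶜ p := by
  have h0 := h.eq_zero hΩ hp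
  obtain ⟨U, hU, hpU, hρ, -, hΩρ⟩ := h
  have hd : DifferentiableAt ℝ ρ p :=
    (hρ.contDiffAt (hU.mem_nhds hpU)).differentiableAt (by simp)
  have hline : HasDerivAt (fun t : ℝ => p + t • v) v 0 := by
    simpa using ((hasDerivAt_id (0 : ℝ)).smul_const v).const_add p
  have hcomp : HasDerivAt (fun t : ℝ => ρ (p + t • v)) (fderiv ℝ ρ p v) 0 := by
    have : HasFDerivAt ρ (fderiv ℝ ρ p) (p + (0 : ℝ) • v) := by simpa using hd.hasFDerivAt
    exact this.comp_hasDerivAt (0 : ℝ) hline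
  have hU' : ∀ᶠ t : ℝ in 𝓝[>] 0, p + t • v ∈ U := by
    refine nhdsWithin_le_nhds (hline.continuousAt.eventually (hU.mem_nhds ?_))
    simpa using hpU
  have hpos : ∀ᶠ t : ℝ in 𝓝[>] 0, 0 < slope (fun t : ℝ => ρ (p + t • v)) 0 t :=
    (hasDerivAt_iff_tendsto_slope.1 hcomp |>.mono_left
      (nhdsWithin_mono _ fun t (ht : 0 < t) => ht.ne')).eventually (lt_mem_nhds hv)
  refine mem_posTangentConeAt_of_frequently_mem (Eventually.frequently ?_)
  filter_upwards [hU', hpos, self_mem_nhdsWithin] with t htU ht (ht0 : 0 < t) htΩ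
  have := (hΩρ _ htU).1 htΩ
  rw [slope_def_field] at ht
  simp only [sub_zero, zero_smul, add_zero, h0] at ht
  exact absurd (pos_of_mul_pos_left (by simpa [div_eq_mul_inv] using ht) (inv_pos.2 ht0).le)
    (not_lt.2 this.le)

/-- A positive conformal factor whose metric makes the boundary of a mean-convex domain minimal
has no local minimum, relative to the exterior, at the boundary. -/
theorem not_isLocalMinOn_of_minimal {Ω : Set (Euc n)} (hn : 2 ≤ n) (hΩ : IsOpen Ω)
    (hΩ_smooth : HasSmoothBoundary Ω) (hΩ_mc : IsMeanConvex Ω)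
    (h_min : HasMinimalBoundary Ω fun y => f y • 1) {p : Euc n} (hp : p ∈ frontier Ω)
    (hf : 0 < f p) : ¬ IsLocalMinOn f Ωᶜ p := by
  intro hmin
  obtain ⟨ρ, hρ⟩ := hΩ_smooth p hp
  have hH0 := hΩ_mc p hp ρ hρ
  have hH := h_min p hp ρ hρ
  set v : Euc n := WithLp.toLp 2 fun i => pderiv Set.univ ρ i p with hv
  have hvρ : fderiv ℝ ρ p v = ∑ k, pderiv Set.univ ρ k p ^ 2 := by
    rw [← fderivWithin_univ, fderiv_apply_eq_sum_pderiv]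
    simp [hv, pow_two]
  have hpos : 0 < ∑ k, pderiv Set.univ ρ k p ^ 2 := by
    refine lt_of_le_of_ne (Finset.sum_nonneg fun _ _ => sq_nonneg _) fun h => ?_
    obtain ⟨U, -, hpU, -, hne, -⟩ := hρ
    refine hne p hpU (ContinuousLinearMap.ext fun w => ?_)
    rw [← fderivWithin_univ, fderiv_apply_eq_sum_pderiv]
    have := (Finset.sum_eq_zero_iff_of_nonneg fun _ _ => sq_nonneg _).1 h.symm
    exact Finset.sum_eq_zero fun i hi => by simp [pow_eq_zero_iff two_ne_zero |>.1 (this i hi)]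
  have hA : 0 ≤ ∑ k, pderiv Set.univ ρ k p * pderiv Ωᶜ f k p := by
    have := hmin.fderivWithin_nonneg
      (hρ.gradient_mem_posTangentConeAt hΩ hp (hvρ ▸ hpos : 0 < fderiv ℝ ρ p v))
    simpa [fderiv_apply_eq_sum_pderiv, hv] using this
  rw [meanCurvature_smul_one ρ hf hpos] at hH
  have hn' : (0 : ℝ) ≤ n - 1 := by
    have : (2 : ℝ) ≤ n := by exact_mod_cast hn
    linarith
  have : 0 < (√(f p))⁻¹ := inv_pos.2 (Real.sqrt_pos.2 hf)
  -- Mean-convexity makes the first summand positive and `hA` makes the second nonnegative.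
  exact absurd hH (by positivity)

/-! ### Superharmonicity of `u` -/

theorem differentiableAt_pderiv (hf : ContDiffAt ℝ 2 f x) (i : Fin n) :
    DifferentiableAt ℝ (pderiv Set.univ f i) x := by
  have h : DifferentiableAt ℝ (fderiv ℝ f) x :=
    (hf.fderiv_right (m := 1) (by norm_num)).differentiableAt one_ne_zero
  unfold pderiv
  simpa only [fderivWithin_univ] using h.clm_apply (differentiableAt_const _)

/-- Nonnegative scalar curvature of `u^{4/(n-2)} δ` makes `u` superharmonic. -/
theorem sum_pderiv_pderiv_nonpos {u : Euc n → ℝ} (hn : 3 ≤ n) (hu : ContDiffOn ℝ ∞ u S)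
    (hpos : ∀ y ∈ S, 0 < u y) (hx : S ∈ 𝓝 x)
    (hR : 0 ≤ scalarCurvature S (conformalMetric u) x) :
    ∑ i, pderiv Set.univ (pderiv Set.univ u i) i x ≤ 0 := by
  have hn' : (3 : ℝ) ≤ n := by exact_mod_cast hn
  have hn2 : (n : ℝ) - 2 ≠ 0 := by linarith
  set a : ℝ := 4 / ((n : ℝ) - 2) with ha
  set f : Euc n → ℝ := fun y => u y ^ a with hfdef
  have hxS := mem_of_mem_nhds hx
  have hux := hpos x hxS
  have hfpos : ∀ y ∈ S, 0 < f y := fun y hy => Real.rpow_pos_of_pos (hpos y hy) _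
  have hP : ∀ y, S ∈ 𝓝 y → ∀ i,
      pderiv S f i y / (2 * f y) = (a / 2) * (pderiv Set.univ u i y / u y) := by
    intro y hy i
    have hyS := mem_of_mem_nhds hy
    have huy := hpos y hyS
    have hd : HasFDerivAt u (fderiv ℝ u y) y :=
      ((hu.contDiffAt hy).differentiableAt (by simp)).hasFDerivAt
    have h1 := (hd.rpow_const (p := a) (Or.inl huy.ne')).fderiv
    simp only [pderiv, fderivWithin_univ, fderivWithin_of_mem_nhds hy, hfdef, h1,
      smul_apply, smul_eq_mul]
    rw [Real.rpow_sub_one huy.ne']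
    have := (Real.rpow_pos_of_pos huy a).ne'
    field_simp
  -- The formula for `∂f / (2f)` is differentiated once more, hence is needed on a neighbourhood.
  have hnear : ∀ᶠ y in 𝓝 x, S ∈ 𝓝 y := eventually_mem_nhds_iff.2 hx
  have hPev : ∀ i, (fun y => pderiv S f i y / (2 * f y))
      =ᶠ[𝓝 x] fun y => (a / 2) * (pderiv Set.univ u i y / u y) :=
    fun i => hnear.mono fun y hy => hP y hy i
  have hcd := hu.contDiffAt hx
  have hdu : DifferentiableAt ℝ u x := hcd.differentiableAt (by simp)
  have hdp : ∀ i, DifferentiableAt ℝ (pderiv Set.univ u i) x :=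
    differentiableAt_pderiv (hcd.of_le (WithTop.coe_le_coe.2 (le_top : (2 : ℕ∞) ≤ ⊤)))
  have hinv : HasFDerivAt (fun y => (u y)⁻¹) (-(u x ^ 2)⁻¹ • fderiv ℝ u x) x :=
    (hasDerivAt_inv hux.ne').comp_hasFDerivAt x hdu.hasFDerivAt
  have hQ : ∀ i, DifferentiableAt ℝ (fun y => (a / 2) * (pderiv Set.univ u i y / u y)) x :=
    by
    simp only [div_eq_mul_inv]
    exact fun i => ((hdp i).fun_mul hinv.differentiableAt).const_mul _
  have hPd : ∀ i, pderiv S (fun y => pderiv S f i y / (2 * f y)) i x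
      = (a / 2) * (pderiv Set.univ (pderiv Set.univ u i) i x / u x
          - (pderiv Set.univ u i x / u x) ^ 2) := by
    intro i
    have h1 := (((hdp i).hasFDerivAt.fun_mul hinv).const_mul (a / 2)).fderiv
    simp only [← div_eq_mul_inv (G := ℝ)] at h1
    rw [pderiv, fderivWithin_of_mem_nhds hx, (hPev i).fderiv_eq, h1]
    simp [pderiv]
    field_simp
    ring
  change 0 ≤ scalarCurvature S (fun y => f y • 1) x at hR
  rw [scalarCurvature_smul_one (fun y hy => (hfpos y hy).ne') hx
    fun i => (hQ i).congr_of_eventuallyEq (hPev i)] at hR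
  simp only [hPd, hP x hx, mul_pow, ← Finset.mul_sum, Finset.sum_sub_distrib,
    ← Finset.sum_div] at hR
  set D := ∑ i, pderiv Set.univ (pderiv Set.univ u i) i x
  set Q := ∑ i, (pderiv Set.univ u i x / u x) ^ 2
  -- The exponent `a = 4/(n-2)` is the one for which the gradient terms `Q` cancel.
  have key : 2 * (a / 2 * (D / u x - Q)) + (n - 2) * ((a / 2) ^ 2 * Q) = a * D / u x := by
    rw [ha]
    field_simp
    ring
  rw [key] at hR
  by_contra! hD
  have h1 : 0 < (f x)⁻¹ := inv_pos.2 (hfpos x hxS)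
  have h2 : 0 < (n : ℝ) - 1 := by linarith
  have h3 : 0 < a := div_pos (by norm_num) (by linarith)
  have : 0 < (f x)⁻¹ * ((n - 1) * (a * D / u x)) := by positivity
  linarith

/-! ### Weak minimum principle -/

/-- A negative second derivative would make `t` a local maximum too, so `h` would be locally
constant and its second derivative zero. -/
theorem deriv_deriv_nonneg_of_isLocalMin {h : ℝ → ℝ} {t : ℝ} (hmin : IsLocalMin h t)
    (hc : ContinuousAt h t) : 0 ≤ deriv (deriv h) t := by
  by_contra! hneg
  have hmax := isLocalMax_of_deriv_deriv_neg hneg hmin.deriv_eq_zero hc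
  have hconst : h =ᶠ[𝓝 t] fun _ => h t := by
    filter_upwards [hmin, hmax] with s h1 h2 using le_antisymm h2 h1
  have : deriv (deriv h) t = 0 := by
    rw [hconst.deriv.deriv_eq]
    simp
  exact hneg.ne this

theorem pderiv_pderiv_nonneg_of_isLocalMin (hmin : IsLocalMin f x) (hf : ContDiffAt ℝ 2 f x)
    (i : Fin n) : 0 ≤ pderiv Set.univ (pderiv Set.univ f i) i x := by
  set e : Euc n := EuclideanSpace.single i 1
  have hline : ∀ t : ℝ, HasDerivAt (fun t : ℝ => x + t • e) e t := fun t => by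
    simpa using ((hasDerivAt_id t).smul_const e).const_add x
  have hx0 : x + (0 : ℝ) • e = x := by simp
  have hcont : Tendsto (fun t : ℝ => x + t • e) (𝓝 0) (𝓝 x) := by
    simpa only [hx0] using (hline 0).continuousAt.tendsto
  have hline_deriv : ∀ (F : Euc n → ℝ) (t : ℝ), DifferentiableAt ℝ F (x + t • e) →
      HasDerivAt (fun t : ℝ => F (x + t • e)) (pderiv Set.univ F i (x + t • e)) t := by
    intro F t hF
    simpa only [pderiv, fderivWithin_univ] using! hF.hasFDerivAt.comp_hasDerivAt t (hline t)
  have hev : ∀ᶠ y in 𝓝 x, DifferentiableAt ℝ f y :=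
    (hf.eventually (by simp)).mono fun y hy => hy.differentiableAt two_ne_zero
  have h1 : deriv (fun t : ℝ => f (x + t • e))
      =ᶠ[𝓝 0] fun t => pderiv Set.univ f i (x + t • e) :=
    (hcont.eventually hev).mono fun t ht => (hline_deriv f t ht).deriv
  have h2 := (hline_deriv (pderiv Set.univ f i) 0
    (by rw [hx0]; exact differentiableAt_pderiv hf i)).deriv
  rw [← h1.deriv_eq, hx0] at h2
  rw [← h2]
  refine deriv_deriv_nonneg_of_isLocalMin ?_ ?_
  · have := hcont.eventually hmin
    simpa [IsLocalMin, IsMinFilter, hx0] using this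
  · exact (hline_deriv f 0 (by rw [hx0]; exact hev.self_of_nhds)).continuousAt

/-- Subtracting `ε‖y‖²` makes a superharmonic function strictly superharmonic. -/
theorem pderiv_pderiv_sub_mul_norm_sq (hf : ContDiffAt ℝ 2 f x) (ε : ℝ) (i : Fin n) :
    pderiv Set.univ (pderiv Set.univ (fun y => f y - ε * ‖y‖ ^ 2) i) i x
      = pderiv Set.univ (pderiv Set.univ f i) i x - 2 * ε := by
  have hev : ∀ᶠ y in 𝓝 x, DifferentiableAt ℝ f y :=
    (hf.eventually (by simp)).mono fun y hy => hy.differentiableAt two_ne_zero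
  have h1 : pderiv Set.univ (fun y => f y - ε * ‖y‖ ^ 2) i
      =ᶠ[𝓝 x] fun y => pderiv Set.univ f i y - 2 * ε * y i := by
    filter_upwards [hev] with y hy
    have h := (hy.hasFDerivAt.fun_sub
      ((hasStrictFDerivAt_norm_sq y).hasFDerivAt.const_mul ε)).fderiv
    simp only [pderiv, fderivWithin_univ, h]
    simp [EuclideanSpace.inner_single_right]
    ring
  have hproj : HasFDerivAt (fun y : Euc n => y i) (EuclideanSpace.proj i : Euc n →L[ℝ] ℝ) x :=
    (EuclideanSpace.proj i : Euc n →L[ℝ] ℝ).hasFDerivAt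
  have h2 := ((differentiableAt_pderiv hf i).hasFDerivAt.fun_sub
    (hproj.const_mul (2 * ε))).fderiv
  rw [pderiv, fderivWithin_univ, h1.fderiv_eq, h2]
  simp [pderiv]

/-- The weak minimum principle: a superharmonic function on a compact set attains its minimum off
the interior. -/
theorem exists_isMinOn_diff_interior {K : Set (Euc n)} (hn : 0 < n) (hK : IsCompact K)
    (hK_ne : K.Nonempty) (hf : ContinuousOn f K) (hf2 : ∀ y ∈ interior K, ContDiffAt ℝ 2 f y)
    (hΔ : ∀ y ∈ interior K, ∑ i, pderiv Set.univ (pderiv Set.univ f i) i y ≤ 0) :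
    ∃ p ∈ K \ interior K, IsMinOn f K p := by
  -- The perturbed function has Laplacian at most `-2nε < 0` in the interior, while at an interior
  -- minimum every `∂ᵢ∂ᵢ` is nonnegative.
  have hex : ∀ ε : ℝ, 0 < ε →
      ∃ q ∈ K \ interior K, ∀ y ∈ K, f q - ε * ‖q‖ ^ 2 ≤ f y - ε * ‖y‖ ^ 2 := by
    intro ε hε
    have hc : ContinuousOn (fun y => f y - ε * ‖y‖ ^ 2) K := hf.sub (by fun_prop)
    obtain ⟨q, hqK, hq⟩ := hK.exists_isMinOn hK_ne hc
    refine ⟨q, ⟨hqK, fun hqi => ?_⟩, hq⟩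
    have hloc : IsLocalMin (fun y => f y - ε * ‖y‖ ^ 2) q :=
      hq.isLocalMin (mem_interior_iff_mem_nhds.1 hqi)
    have hcd : ContDiffAt ℝ 2 (fun y => f y - ε * ‖y‖ ^ 2) q :=
      (hf2 q hqi).sub (contDiffAt_const.mul (contDiff_norm_sq ℝ).contDiffAt)
    have hsum : 0 ≤ ∑ i, (pderiv Set.univ (pderiv Set.univ f i) i q - 2 * ε) :=
      Finset.sum_nonneg fun i _ => by
        rw [← pderiv_pderiv_sub_mul_norm_sq (hf2 q hqi)]
        exact pderiv_pderiv_nonneg_of_isLocalMin hloc hcd i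
    rw [Finset.sum_sub_distrib] at hsum
    simp only [Finset.sum_const, Finset.card_univ, Fintype.card_fin, nsmul_eq_mul] at hsum
    have : (0 : ℝ) < n := by exact_mod_cast hn
    have : 0 < n * (2 * ε) := by positivity
    linarith [hΔ q hqi]
  have hbd : IsCompact (K \ interior K) := hK.diff isOpen_interior
  obtain ⟨q, hq, -⟩ := hex 1 one_pos
  obtain ⟨p, hp, hpmin⟩ := hbd.exists_isMinOn ⟨q, hq⟩ (hf.mono Set.sdiff_subset)
  obtain ⟨C, hC⟩ := hK.isBounded.exists_norm_le
  refine ⟨p, hp, fun y hy => ?_⟩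
  -- Since `p` does not depend on `ε`, it suffices to let `ε → 0` in `f p - εC² ≤ f y`; no limit of
  -- the perturbed minimizers is needed.
  have hlim : Tendsto (fun ε : ℝ => f p - ε * C ^ 2) (𝓝[>] 0) (𝓝 (f p)) := by
    have : Continuous fun ε : ℝ => f p - ε * C ^ 2 := by fun_prop
    simpa using (this.tendsto 0).mono_left nhdsWithin_le_nhds
  refine le_of_tendsto hlim ?_
  filter_upwards [self_mem_nhdsWithin] with ε (hε : 0 < ε)
  obtain ⟨r, hr, hrmin⟩ := hex ε hε
  have h1 : f p ≤ f r := hpmin hr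
  have h2 := hrmin y hy
  have h3 : ε * ‖r‖ ^ 2 ≤ ε * C ^ 2 := by
    gcongr
    exact hC r hr.1
  have h4 : 0 ≤ ε * ‖y‖ ^ 2 := by positivity
  linarith

end ConfFlat

/-! ### Conclusion -/

theorem mainTheorem2 (n : ℕ) (hn : 3 ≤ n)
    (Ω : Set (Euc n)) (hΩ_nonempty : Ω.Nonempty) (hΩ_open : IsOpen Ω)
    (hΩ_bounded : Bornology.IsBounded Ω)
    (hΩ_smooth : ConfFlat.HasSmoothBoundary Ω) (hΩ_mc : ConfFlat.IsMeanConvex Ω)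
    (u : Euc n → ℝ) (hu_smooth : ContDiffOn ℝ ∞ u Ωᶜ) (hu_pos : ∀ x ∈ Ωᶜ, 0 < u x)
    (h_af : ConfFlat.IsAsymptoticallyFlat Ωᶜ (ConfFlat.conformalMetric u))
    (h_scal : ∀ x ∈ Ωᶜ, 0 ≤ ConfFlat.scalarCurvature Ωᶜ (ConfFlat.conformalMetric u) x)
    (h_min : ConfFlat.HasMinimalBoundary Ω (ConfFlat.conformalMetric u))
    (hu_lim : Tendsto u (Bornology.cobounded (Euc n)) (𝓝 1)) :
    ∀ x ∈ Ωᶜ, 1 ≤ u x := by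
  intro x hx
  by_contra! hx1
  obtain ⟨R₀, -, hR₀⟩ := (hasBasis_cobounded_norm (E := Euc n)).eventually_iff.1
    (hu_lim.eventually (lt_mem_nhds hx1))
  -- `R ≥ R₀` keeps `u > u x` on the outer sphere, and `R ≥ ‖x‖` puts `x` in `K`.
  set R := max R₀ ‖x‖ with hR
  set K := Ωᶜ ∩ Metric.closedBall (0 : Euc n) R with hK
  have hKc : IsCompact K := (isCompact_closedBall _ _).inter_left hΩ_open.isClosed_compl
  have hxK : x ∈ K := ⟨hx, by simp [hR]⟩
  have hnhds : ∀ y ∈ interior K, Ωᶜ ∈ 𝓝 y := fun y hy =>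
    mem_of_superset (mem_interior_iff_mem_nhds.1 hy) Set.inter_subset_left
  obtain ⟨p, ⟨hpK, hpi⟩, hpmin⟩ := ConfFlat.exists_isMinOn_diff_interior (f := u) (by omega) hKc
    ⟨x, hxK⟩ (hu_smooth.continuousOn.mono Set.inter_subset_left)
    (fun y hy => (hu_smooth.contDiffAt (hnhds y hy)).of_le (WithTop.coe_le_coe.2 (le_top : (2 : ℕ∞) ≤ ⊤)))
    (fun y hy => ConfFlat.sum_pderiv_pderiv_nonpos hn hu_smooth hu_pos (hnhds y hy)
      (h_scal y (mem_of_mem_nhds (hnhds y hy))))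
  have hpx : u p ≤ u x := hpmin hxK
  have hpR : ‖p‖ < R := by
    by_contra! h
    exact absurd (hR₀ ((le_max_left _ _).trans h)) (not_lt.2 hpx)
  have hball : Metric.closedBall (0 : Euc n) R ∈ 𝓝 p :=
    mem_of_superset (Metric.isOpen_ball.mem_nhds (by simpa using hpR)) Metric.ball_subset_closedBall
  -- Inside the open ball, the only points of `K` off its interior lie on `∂Ω`.
  have hpf : p ∈ frontier Ω := by
    rw [hΩ_open.frontier_eq]
    refine ⟨?_, hpK.1⟩
    by_contra hcl
    refine hpi (mem_interior_iff_mem_nhds.2 (inter_mem ?_ hball))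
    rw [← mem_interior_iff_mem_nhds, interior_compl]
    exact hcl
  -- The boundary lemma concerns the conformal factor; the minimum of `u` passes to it because `t ↦
  -- t^{4/(n-2)}` is increasing.
  refine ConfFlat.not_isLocalMinOn_of_minimal (by omega) hΩ_open hΩ_smooth hΩ_mc h_min hpf
    (Real.rpow_pos_of_pos (hu_pos p hpK.1) _) ?_
  have ha : 0 ≤ 4 / ((n : ℝ) - 2) := by
    have : (3 : ℝ) ≤ n := by exact_mod_cast hn
    exact div_nonneg (by norm_num) (by linarith)
  filter_upwards [self_mem_nhdsWithin, mem_nhdsWithin_of_mem_nhds hball] with y hy hyR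
  exact Real.rpow_le_rpow (hu_pos p hpK.1).le (hpmin ⟨hy, hyR⟩) ha
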